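/- For a subset $X$ of an Abelian group $G$ and an integer $n\ge 1$ write $nX=\{x_1+\dots+x_n : x_1,\dots,x_n\in X\}$ and $X-X=\{x-y : x,y\in X\}$. A \emph{$k$-dimensional centred convex coset progression} in $G$ is a set of the form $M=H+\phi(Q\cap\mathbb{Z}^k)$, where $H$ is a subgroup of $G$, $Q\subset\mathbb{R}^k$ is a convex body (a compact convex set with non-empty interior) symmetric about the origin, and $\phi:\mathbb{Z}^k\to G$ is a homomorphism. \textbf{Theorem.} There is an absolute constant $C>0$ such that the following holds. Let $G$ be an Abelian group, let $X\subset G$ be finite and non-empty, and let $d$ be a real number such that $X$ has relative polynomial growth of order $d$, that is, $|nX|\le n^d|X|$ for all integers $n\ge 1$. Put $D=\max(d,2)$. Then there are an integer $k\ge 0$ and a finite $k$-dimensional centred convex coset progression $M$ in $G$ such that $$X-X\subset M,\qquad |M|\le \exp(C D\log D)\,|X|,\qquad k\le C D\log D .$$ In particular, for $d\ge 2$ one has $|M|\le\exp(O(d\log d))|X|$ and $\dim M=O(d\log d)$. -/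

import Mathlib

open scoped Pointwise

/-- The `n`-fold sumset `nX = {x₁ + ⋯ + xₙ : x₁, …, xₙ ∈ X}` (not the dilate of `X` by `n`). -/
def iteratedSumset {G : Type*} [AddCommGroup G] (n : ℕ) (X : Set G) : Set G :=
  {g | ∃ x : Fin n → G, (∀ i, x i ∈ X) ∧ g = ∑ i, x i}

/-- Relative polynomial growth of order `d` (for finite sets `X`):
`|nX| ≤ n ^ d |X|` for all integers `n ≥ 1`. -/
def HasRelativePolynomialGrowth {G : Type*} [AddCommGroup G] (d : ℝ) (X : Set G) : Prop :=
  ∀ n : ℕ, 1 ≤ n → ((iteratedSumset n X).ncard : ℝ) ≤ (n : ℝ) ^ d * (X.ncard : ℝ)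

/-- `Q` is a convex body in `ℝᵏ` (convex, compact, with non-empty interior) that is
symmetric about the origin. -/
structure IsSymmetricConvexBody {k : ℕ} (Q : Set (Fin k → ℝ)) : Prop where
  convex : Convex ℝ Q
  isCompact : IsCompact Q
  interior_nonempty : (interior Q).Nonempty
  neg_mem : ∀ x ∈ Q, -x ∈ Q

/-- `P` is a `k`-dimensional convex progression in `G`: `P = φ(Q ∩ ℤᵏ)` for a symmetric convex
body `Q` in `ℝᵏ` and a homomorphism `φ : ℤᵏ → G`. -/
def IsConvexProgression {G : Type*} [AddCommGroup G] (k : ℕ) (P : Set G) : Prop :=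
  ∃ (Q : Set (Fin k → ℝ)) (φ : (Fin k → ℤ) →+ G), IsSymmetricConvexBody Q ∧
    P = φ '' {z : Fin k → ℤ | (fun i => (z i : ℝ)) ∈ Q}

/-- `M` is a `k`-dimensional centred convex coset progression in `G`: `M = H + P` with `H` a
subgroup of `G` (a coset through the origin) and `P` a `k`-dimensional convex progression. -/
def IsCentredConvexCosetProgression {G : Type*} [AddCommGroup G] (k : ℕ) (M : Set G) : Prop :=
  ∃ (H : AddSubgroup G) (P : Set G), IsConvexProgression k P ∧ M = (H : Set G) + P

universe u

/-! ### Characters of a discrete abelian group -/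

/-! Let q = ⌈max(d,2)⌉. Polynomial growth forces some A = nX, with n at most a power of q, to
satisfy |A + X| ≤ (1 + q⁻²⁰)|A| (`exists_card_nsmul_add_le`). Consider the Bohr sets of the large
spectrum of A, that is, of the characters ψ with |∑_{a ∈ A} ψ(a)| ≥ |A|/2. Almost invariance makes
these characters nearly 1 on X - X, so X - X lies in the Bohr set of a tiny width δ
(`abs_arg_sub_le`). Bogolyubov's argument with q⁸ + 1 summands puts the Bohr set of width 1 inside
mA - mA, m = q⁸ + 1 (`mem_nsmul_sub_nsmul_of_abs_arg_le`), which has size at most q^(76q)|X|. The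
vectors of arguments of the width-δ Bohr set generate a lattice, discrete because the width-1 Bohr
set is finite. The width-δ Bohr set is therefore the common kernel of the characters plus an image
of the lattice points in a ball, that is, a convex coset progression. Its dimension k is bounded by
packing: k lattice generators independent mod 2 give 2^k disjoint copies of the width-δ set inside
the width-1 set, as long as (k + 2)δ ≤ 1. Hence 2^k ≤ q^(76q), and k = O(q log q). -/

/-- The characters of an abelian group separate points. -/
theorem exists_addChar_circle_ne_one {G : Type*} [AddCommGroup G] {x : G} (hx : x ≠ 0) :
    ∃ ψ : AddChar G Circle, ψ x ≠ 1 := by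
  obtain ⟨c, hc⟩ := CharacterModule.exists_character_apply_ne_zero_of_ne_zero hx
  -- `CharacterModule` takes values in ℚ/ℤ, which embeds in ℝ/ℤ and hence in the circle.
  let j : AddCircle (1 : ℚ) →+ AddCircle (1 : ℝ) :=
    QuotientAddGroup.map _ _ (Rat.castHom ℝ).toAddMonoidHom (by
      intro q hq
      obtain ⟨n, rfl⟩ := AddSubgroup.mem_zmultiples_iff.1 hq
      refine AddSubgroup.mem_zmultiples_iff.2 ⟨n, ?_⟩
      simp)
  have hj : ∀ y, j y = 0 → y = 0 := by
    intro y
    induction y using QuotientAddGroup.induction_on with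
    | H q =>
      intro h
      have h' : ((q : ℝ) : AddCircle (1 : ℝ)) = 0 := h
      obtain ⟨n, hn⟩ := (AddCircle.coe_eq_zero_iff (1 : ℝ)).1 h'
      refine (AddCircle.coe_eq_zero_iff (1 : ℚ)).2 ⟨n, ?_⟩
      have : (n : ℝ) = q := by simpa using hn
      have : (n : ℚ) = q := by exact_mod_cast this
      simpa using this
  refine ⟨⟨fun y => (j (c y)).toCircle, by simp, fun a b => ?_⟩, fun h => hc (hj _ ?_)⟩
  · rw [map_add, map_add, AddCircle.toCircle_add]
  · exact AddCircle.injective_toCircle one_ne_zero (h.trans AddCircle.toCircle_zero.symm)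

open MeasureTheory in
/-- The dual of an abelian group `G` carries a probability measure for which the elements of `G`
form an orthonormal family of functions. -/
theorem exists_dual_probability (G : Type u) [AddCommGroup G] :
    ∃ (Ω : Type u) (_ : MeasurableSpace Ω) (μ : Measure Ω) (e : Ω → AddChar G Circle),
      IsProbabilityMeasure μ ∧ (∀ x, Measurable fun ω => (e ω x : ℂ)) ∧
      ∀ x, x ≠ 0 → ∫ ω, (e ω x : ℂ) ∂μ = 0 := by
  -- With the discrete topology on G the dual is compact, so Haar measure can be normalised to total
  -- mass 1.
  let : TopologicalSpace (Multiplicative G) := ⊥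
  have : DiscreteTopology (Multiplicative G) := ⟨rfl⟩
  let Ω := PontryaginDual (Multiplicative G)
  let : MeasurableSpace Ω := borel Ω
  have : BorelSpace Ω := ⟨rfl⟩
  let K : TopologicalSpace.PositiveCompacts Ω := ⊤
  let e : Ω → AddChar G Circle := fun ω =>
    ⟨fun x => ω (Multiplicative.ofAdd x), map_one ω, fun a b => map_mul ω _ _⟩
  have hc : ∀ x, Continuous fun ω => (e ω x : ℂ) := by
    intro x
    have : Continuous fun ω : Multiplicative G →ₜ* Circle => ω (Multiplicative.ofAdd x) :=
      (ContinuousEvalConst.continuous_eval_const (F := C(Multiplicative G, Circle))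
        (Multiplicative.ofAdd x)).comp
        (ContinuousMonoidHom.isInducing_toContinuousMap _ _).continuous
    exact Continuous.comp (g := ((↑) : Circle → ℂ)) (by fun_prop) this
  refine ⟨Ω, inferInstance, Measure.haarMeasure K, e, ⟨?_⟩, fun x => (hc x).measurable, ?_⟩
  · have := Measure.haarMeasure_self (K₀ := K)
    simpa [K] using this
  · intro x hx
    obtain ⟨ψ, hψ⟩ := exists_addChar_circle_ne_one hx
    let ω₀ : Ω := (⟨⟨⟨fun y => ψ y.toAdd, ψ.map_zero_eq_one⟩, fun a b => ψ.map_add_eq_mul _ _⟩,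
      continuous_of_discreteTopology⟩ : Multiplicative G →ₜ* Circle)
    -- Translation by ω₀ multiplies the integral by ψ(x) ≠ 1 yet leaves it unchanged.
    have h := integral_mul_left_eq_self (μ := Measure.haarMeasure K)
      (fun ω => (e ω x : ℂ)) ω₀
    have h2 : ∀ ω, (e (ω₀ * ω) x : ℂ) = (ψ x : ℂ) * (e ω x : ℂ) := by
      intro ω
      rw [← Circle.coe_mul]
      rfl
    simp only [h2] at h
    rw [integral_const_mul] at h
    have h3 : ((ψ x : ℂ) - 1) * ∫ ω, (e ω x : ℂ) ∂(Measure.haarMeasure K) = 0 := by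
      rw [sub_mul, h, one_mul, sub_self]
    rcases mul_eq_zero.1 h3 with h4 | h4
    · exact absurd (Circle.ext (by simpa using sub_eq_zero.1 h4)) hψ
    · exact h4

/-! ### Bogolyubov's argument with many summands -/

/-- Powers of an exponential sum over `A` are weighted exponential sums over `m • A`. -/
theorem exists_weight_pow_sum {G : Type*} [AddCommGroup G] [DecidableEq G] (A : Finset G) (m : ℕ) :
    ∃ w : G → ℝ, ∀ ψ : AddChar G Circle,
      (∑ a ∈ A, (ψ a : ℂ)) ^ m = ∑ y ∈ m • A, (w y : ℂ) * (ψ y : ℂ) := by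
  induction m with
  | zero => exact ⟨fun _ => 1, fun ψ => by rw [zero_nsmul]; simp [← Finset.singleton_zero]⟩
  | succ m ih =>
    obtain ⟨w, hw⟩ := ih
    refine ⟨fun y => ∑ z ∈ m • A, ∑ a ∈ A, if z + a = y then w z else 0, fun ψ => ?_⟩
    rw [pow_succ, hw, Finset.sum_mul_sum]
    push_cast
    simp_rw [Finset.sum_mul]
    conv_rhs => rw [Finset.sum_comm]
    refine Finset.sum_congr rfl fun z hz => ?_
    conv_rhs => rw [Finset.sum_comm]
    refine Finset.sum_congr rfl fun a ha => ?_
    have hza : z + a ∈ (m + 1) • A := by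
      rw [succ_nsmul]; exact Finset.add_mem_add hz ha
    rw [Finset.sum_eq_single_of_mem _ hza]
    · simp [AddChar.map_add_eq_mul, mul_assoc]
    · intro b _ hb
      simp [Ne.symm hb]

-- Expanding the square and using orthogonality leaves only the pairs with difference x. The
-- integral is thus zero when x ∉ Y - Y, and at x = 0 this is Parseval.
open MeasureTheory in
theorem integral_char_mul_norm_sq {G : Type*} [AddCommGroup G] [DecidableEq G]
    {Ω : Type*} [MeasurableSpace Ω] (μ : Measure Ω) [IsProbabilityMeasure μ]
    (e : Ω → AddChar G Circle) (hm : ∀ x, Measurable fun ω => (e ω x : ℂ))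
    (h0 : ∀ x, x ≠ 0 → ∫ ω, (e ω x : ℂ) ∂μ = 0) (Y : Finset G) (w : G → ℝ) (x : G) :
    ∫ ω, (e ω x : ℂ) * ((‖∑ y ∈ Y, (w y : ℂ) * (e ω y : ℂ)‖ ^ 2 : ℝ) : ℂ) ∂μ =
      ∑ y ∈ Y, ∑ z ∈ Y, if x + y = z then ((w y * w z : ℝ) : ℂ) else 0 := by
  have hi : ∀ x, Integrable (fun ω => (e ω x : ℂ)) μ := fun x =>
    Integrable.of_bound (hm x).aestronglyMeasurable 1 (by simp [Circle.norm_coe])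
  have hx : ∀ x, ∫ ω, (e ω x : ℂ) ∂μ = if x = 0 then 1 else 0 := by
    intro x
    split_ifs with h
    · subst h; simp
    · exact h0 x h
  have key : ∀ ω, (e ω x : ℂ) * ((‖∑ y ∈ Y, (w y : ℂ) * (e ω y : ℂ)‖ ^ 2 : ℝ) : ℂ) =
      ∑ y ∈ Y, ∑ z ∈ Y, ((w y * w z : ℝ) : ℂ) * (e ω (x + y - z) : ℂ) := by
    intro ω
    rw [Complex.ofReal_pow, ← Complex.mul_conj', map_sum, Finset.sum_mul_sum, Finset.mul_sum]
    refine Finset.sum_congr rfl fun y _ => ?_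
    rw [Finset.mul_sum]
    refine Finset.sum_congr rfl fun z _ => ?_
    rw [map_mul, Complex.conj_ofReal, ← Circle.coe_inv_eq_conj, sub_eq_add_neg,
      AddChar.map_add_eq_mul, AddChar.map_add_eq_mul, AddChar.map_neg_eq_inv]
    push_cast
    ring
  simp_rw [key]
  rw [integral_finsetSum _ fun y _ => integrable_finsetSum _ fun z _ => (hi _).const_mul _]
  refine Finset.sum_congr rfl fun y _ => ?_
  rw [integral_finsetSum _ fun z _ => (hi _).const_mul _]
  refine Finset.sum_congr rfl fun z _ => ?_
  rw [integral_const_mul, hx]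
  simp [sub_eq_zero]

theorem half_le_re_of_abs_arg_le_one {z : Circle} (h : |Complex.arg z| ≤ 1) :
    1 / 2 ≤ (z : ℂ).re := by
  have h1 : (z : ℂ).re = Real.cos |Complex.arg z| := by
    rw [Real.cos_abs, Complex.cos_arg z.coe_ne_zero, Circle.norm_coe, div_one]
  rw [h1, ← Real.cos_pi_div_three]
  refine Real.cos_le_cos_of_nonneg_of_le_pi (abs_nonneg _) ?_ ?_
  · linarith [Real.pi_pos]
  · linarith [Real.pi_gt_three]

open MeasureTheory in
/-- If `|m A|` is small compared with `4 ^ m |A|`, then the Bohr set of the large spectrum of `A`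
is contained in `m A - m A`. -/
theorem mem_nsmul_sub_nsmul_of_abs_arg_le {G : Type*} [AddCommGroup G] [DecidableEq G]
    {Ω : Type*} [MeasurableSpace Ω] (μ : Measure Ω) [IsProbabilityMeasure μ]
    (e : Ω → AddChar G Circle) (hm : ∀ x, Measurable fun ω => (e ω x : ℂ))
    (h0 : ∀ x, x ≠ 0 → ∫ ω, (e ω x : ℂ) ∂μ = 0) {A : Finset G} (hA : A.Nonempty) {m : ℕ}
    (hcard : 3 * (((m + 1) • A).card : ℝ) < 4 ^ m * A.card) {x : G}
    (hx : ∀ ω, (A.card : ℝ) / 2 ≤ ‖∑ a ∈ A, (e ω a : ℂ)‖ → |Complex.arg (e ω x)| ≤ 1) :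
    x ∈ (m + 1) • A - (m + 1) • A := by
  by_contra hxn
  obtain ⟨w, hw⟩ := exists_weight_pow_sum A (m + 1)
  set Y := (m + 1) • A with hY
  set f : Ω → ℂ := fun ω => ∑ a ∈ A, (e ω a : ℂ) with hf
  set α : ℝ := (A.card : ℝ) with hα
  have hα0 : 0 < α := by simpa [hα] using hA
  have hfm : Measurable f := Finset.measurable_fun_sum _ fun a _ => hm a
  have hfb : ∀ ω, ‖f ω‖ ≤ α := fun ω => (norm_sum_le _ _).trans (by simp [hα, Circle.norm_coe])
  have hpow : ∀ ω, ‖f ω‖ ^ (2 * (m + 1)) = ‖∑ y ∈ Y, (w y : ℂ) * (e ω y : ℂ)‖ ^ 2 := by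
    intro ω
    rw [← hw, norm_pow, ← pow_mul, mul_comm]
  have hint : ∀ j, Integrable (fun ω => ‖f ω‖ ^ j) μ := fun j =>
    Integrable.of_bound (hfm.norm.pow_const j).aestronglyMeasurable (α ^ j)
      (by filter_upwards with ω
          rw [norm_pow, norm_norm]
          exact pow_le_pow_left₀ (norm_nonneg _) (hfb ω) j)
  have hint2 : Integrable (fun ω => (e ω x : ℂ) * ((‖f ω‖ ^ (2 * (m + 1)) : ℝ) : ℂ)) μ := by
    refine ((hint (2 * (m + 1))).ofReal (𝕜 := ℂ)).bdd_mul (c := 1)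
      (hm x).aestronglyMeasurable (by simp [Circle.norm_coe])

  have hzero : ∫ ω, (e ω x : ℂ) * ((‖f ω‖ ^ (2 * (m + 1)) : ℝ) : ℂ) ∂μ = 0 := by
    simp_rw [hpow]
    rw [integral_char_mul_norm_sq μ e hm h0]
    refine Finset.sum_eq_zero fun y hy => Finset.sum_eq_zero fun z hz => if_neg fun h => hxn ?_
    rw [← eq_sub_iff_add_eq] at h
    exact h ▸ Finset.sub_mem_sub hz hy
  have hmain : ∫ ω, ‖f ω‖ ^ (2 * (m + 1)) ∂μ = ∑ y ∈ Y, w y ^ 2 := by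
    have h := integral_char_mul_norm_sq μ e hm h0 Y w 0
    simp only [AddChar.map_zero_eq_one, Circle.coe_one, one_mul, zero_add, Finset.sum_ite_eq] at h
    rw [integral_complex_ofReal] at h
    simp_rw [hpow]
    apply Complex.ofReal_injective
    refine h.trans ?_
    push_cast
    refine Finset.sum_congr rfl fun y hy => ?_
    rw [if_pos hy, sq]
  have hsq : ∫ ω, ‖f ω‖ ^ 2 ∂μ = α := by
    have h := integral_char_mul_norm_sq μ e hm h0 A (fun _ => 1) 0
    simp only [AddChar.map_zero_eq_one, Circle.coe_one, one_mul, zero_add, Finset.sum_ite_eq,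
      Complex.ofReal_one] at h
    rw [integral_complex_ofReal] at h
    apply Complex.ofReal_injective
    refine h.trans ?_
    rw [Finset.sum_congr rfl fun y hy => if_pos hy]
    simp [hα]
  have hsum : ∑ y ∈ Y, w y = α ^ (m + 1) := by
    have h := hw 1
    simp only [AddChar.one_apply, Circle.coe_one, mul_one, Finset.sum_const, nsmul_eq_mul] at h
    apply Complex.ofReal_injective
    push_cast
    rw [← h, hα]
    simp
  have hCS : (α ^ (m + 1)) ^ 2 ≤ (Y.card : ℝ) * ∑ y ∈ Y, w y ^ 2 := by
    rw [← hsum]; exact sq_sum_le_card_mul_sum_sq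
  -- On the large spectrum the real part of the character is at least 1/2. Elsewhere it is at least
  -- -1, a loss of 3/2 against 1/2, but there ‖f‖ ≤ α/2. Integrating and combining with `hCS` gives
  -- 4^m α ≤ 3|Y|, contrary to `hcard`.
  have hpt : ∀ ω, 1 / 2 * ‖f ω‖ ^ (2 * (m + 1)) - 3 / 2 * (α / 2) ^ (2 * m) * ‖f ω‖ ^ 2 ≤
      ((e ω x : ℂ) * ((‖f ω‖ ^ (2 * (m + 1)) : ℝ) : ℂ)).re := by
    intro ω
    rw [Complex.re_mul_ofReal]
    have hn : 0 ≤ ‖f ω‖ ^ (2 * (m + 1)) := by positivity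
    by_cases hω : α / 2 ≤ ‖f ω‖
    · have h1 := half_le_re_of_abs_arg_le_one (hx ω hω)
      have h2 := mul_le_mul_of_nonneg_right h1 hn
      have : 0 ≤ 3 / 2 * (α / 2) ^ (2 * m) * ‖f ω‖ ^ 2 := by positivity
      linarith
    · have h1 : -1 ≤ (e ω x : ℂ).re := by
        have := Complex.abs_re_le_norm (e ω x : ℂ)
        rw [Circle.norm_coe] at this
        exact (abs_le.1 this).1
      have h2 := mul_le_mul_of_nonneg_right h1 hn
      have h3 : ‖f ω‖ ^ (2 * (m + 1)) ≤ (α / 2) ^ (2 * m) * ‖f ω‖ ^ 2 := by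
        rw [mul_add, pow_add]
        exact mul_le_mul_of_nonneg_right
          (pow_le_pow_left₀ (norm_nonneg _) (not_le.1 hω).le _) (by positivity)
      linarith
  have hle := integral_mono (((hint (2 * (m + 1))).const_mul (1 / 2)).sub
    ((hint 2).const_mul (3 / 2 * (α / 2) ^ (2 * m)))) hint2.re hpt
  have hre : ∫ ω, ((e ω x : ℂ) * ((‖f ω‖ ^ (2 * (m + 1)) : ℝ) : ℂ)).re ∂μ = 0 := by
    have := integral_re hint2
    rw [hzero] at this
    simpa using this
  erw [integral_sub ((hint (2 * (m + 1))).const_mul (1 / 2))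
    ((hint 2).const_mul (3 / 2 * (α / 2) ^ (2 * m))), integral_const_mul, integral_const_mul,
    hmain, hsq, hre] at hle
  have h4 : (∑ y ∈ Y, w y ^ 2) * 4 ^ m ≤ 3 * α ^ (2 * m) * α := by
    have : (α / 2) ^ (2 * m) * 4 ^ m = α ^ (2 * m) := by
      rw [pow_mul, ← mul_pow, pow_mul]
      congr 1
      ring
    have h5 : ∑ y ∈ Y, w y ^ 2 ≤ 3 * (α / 2) ^ (2 * m) * α := by linarith
    calc _ ≤ 3 * (α / 2) ^ (2 * m) * α * 4 ^ m :=
          mul_le_mul_of_nonneg_right h5 (by positivity)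
      _ = 3 * ((α / 2) ^ (2 * m) * 4 ^ m) * α := by ring
      _ = _ := by rw [this]
  have h6 : α ^ (2 * m + 1) * (4 ^ m * α) ≤ α ^ (2 * m + 1) * (3 * Y.card) := by
    calc α ^ (2 * m + 1) * (4 ^ m * α) = (α ^ (m + 1)) ^ 2 * 4 ^ m := by ring
      _ ≤ (Y.card * ∑ y ∈ Y, w y ^ 2) * 4 ^ m := by gcongr
      _ = Y.card * ((∑ y ∈ Y, w y ^ 2) * 4 ^ m) := by ring
      _ ≤ Y.card * (3 * α ^ (2 * m) * α) := by gcongr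
      _ = _ := by ring
  have h7 := le_of_mul_le_mul_left h6 (by positivity)
  linarith

/-- If `A` is almost invariant under translation by `X`, then the large spectrum of `A` is almost
trivial on `X - X`. -/
theorem abs_arg_sub_le {G : Type*} [AddCommGroup G] [DecidableEq G] {A X : Finset G}
    (hA : A.Nonempty) {η : ℝ} (hη : ((A + X).card : ℝ) ≤ (1 + η) * A.card) (ψ : AddChar G Circle)
    (hψ : (A.card : ℝ) / 2 ≤ ‖∑ a ∈ A, (ψ a : ℂ)‖) {x y : G} (hx : x ∈ X) (hy : y ∈ X) :
    |Complex.arg (ψ (x - y))| ≤ 7 * η := by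
  set S : ℂ := ∑ a ∈ A, (ψ a : ℂ)
  have hα0 : (0 : ℝ) < A.card := by simpa using hA
  -- The translate A + x fills all but η|A| elements of A + X, so ψ(x)S is close to a sum that does
  -- not depend on x.
  have key : ∀ x ∈ X, ‖∑ z ∈ A + X, (ψ z : ℂ) - (ψ x : ℂ) * S‖ ≤ η * A.card := by
    intro x hx
    have h1 : (ψ x : ℂ) * S = ∑ z ∈ A + {x}, (ψ z : ℂ) := by
      rw [Finset.add_singleton, Finset.vadd_finset_def, Finset.sum_image (by simp), Finset.mul_sum]
      refine Finset.sum_congr rfl fun a _ => ?_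
      rw [op_vadd_eq_add, AddChar.map_add_eq_mul, Circle.coe_mul, mul_comm]
    have hs : A + {x} ⊆ A + X := Finset.add_subset_add_left (by simpa using hx)
    rw [h1, ← Finset.sum_sdiff hs, add_sub_cancel_right]
    refine (norm_sum_le _ _).trans ?_
    have h2 := Finset.card_sdiff_add_card_eq_card hs
    have h3 : (A + {x}).card = A.card := by simp [Finset.add_singleton]
    rw [h3] at h2
    have h4 : (((A + X) \ (A + {x})).card : ℝ) + A.card = (A + X).card := by exact_mod_cast h2
    simp only [Circle.norm_coe, Finset.sum_const, nsmul_eq_mul, mul_one]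
    linarith
  have hd : ‖((ψ x : ℂ) - ψ y) * S‖ ≤ 2 * η * A.card := by
    have : ((ψ x : ℂ) - ψ y) * S = (∑ z ∈ A + X, (ψ z : ℂ) - (ψ y : ℂ) * S) -
        (∑ z ∈ A + X, (ψ z : ℂ) - (ψ x : ℂ) * S) := by ring
    rw [this]
    refine (norm_sub_le _ _).trans ?_
    linarith [key x hx, key y hy]
  have hxy : ‖(ψ (x - y) : ℂ) - 1‖ = ‖(ψ x : ℂ) - ψ y‖ := by
    have : (ψ x : ℂ) - ψ y = ((ψ (x - y) : ℂ) - 1) * ψ y := by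
      rw [sub_mul, one_mul, ← Circle.coe_mul, ← AddChar.map_add_eq_mul, sub_add_cancel]
    rw [this, norm_mul, Circle.norm_coe, mul_one]
  have h4 : ‖(ψ (x - y) : ℂ) - 1‖ ≤ 4 * η := by
    rw [norm_mul, ← hxy] at hd
    have := mul_le_mul_of_nonneg_left hψ (norm_nonneg ((ψ (x - y) : ℂ) - 1))
    have h5 : ‖(ψ (x - y) : ℂ) - 1‖ * A.card ≤ 4 * η * A.card := by linarith
    exact le_of_mul_le_mul_right h5 hα0
  have h5 := Complex.angle_le_mul_norm_sub (x := (ψ (x - y) : ℂ)) (y := 1) (Circle.norm_coe _) norm_one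
  rw [Complex.angle_one_right (Circle.coe_ne_zero _)] at h5
  have h6 : 0 ≤ η := by linarith [norm_nonneg ((ψ (x - y) : ℂ) - 1)]
  calc _ ≤ Real.pi / 2 * ‖(ψ (x - y) : ℂ) - 1‖ := h5
    -- The constant 7 is an upper bound for 2π.
    _ ≤ Real.pi / 2 * (4 * η) := by gcongr
    _ ≤ 7 * η := by nlinarith [Real.pi_lt_d2]

/-! ### Bohr sets as convex coset progressions -/

section BohrSet

open BoundedContinuousFunction Module

variable {G ι : Type*} [AddCommGroup G]

/-- The Bohr set of width `r` (measured by the argument) of a family of characters. -/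
def bohrSet (e : ι → AddChar G Circle) (r : ℝ) : Set G :=
  {x | ∀ i, |Complex.arg (e i x)| ≤ r}

theorem bohrSet_mono (e : ι → AddChar G Circle) {r s : ℝ} (h : r ≤ s) :
    bohrSet e r ⊆ bohrSet e s := fun _ hx i => (hx i).trans h

variable [TopologicalSpace ι]

/-- The group of pairs `(x, w)` such that `w i` is an argument of `e i x` for all `i`. -/
noncomputable def argGraph (e : ι → AddChar G Circle) : AddSubgroup (G × (ι →ᵇ ℝ)) where
  carrier := {p | ∀ i, Circle.exp (p.2 i) = e i p.1}
  zero_mem' i := by simp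
  add_mem' {p q} hp hq i := by
    simp only [Set.mem_ofPred_eq] at hp hq
    simp [Circle.exp_add, AddChar.map_add_eq_mul, hp i, hq i]
  neg_mem' {p} hp i := by
    simp only [Set.mem_ofPred_eq] at hp
    simp [Circle.exp_neg, AddChar.map_neg_eq_inv, hp i]

theorem mem_argGraph {e : ι → AddChar G Circle} {x : G} {w : ι →ᵇ ℝ} :
    (x, w) ∈ argGraph e ↔ ∀ i, Circle.exp (w i) = e i x := Iff.rfl

variable [DiscreteTopology ι]

/-- The vector of arguments of the values of a family of characters. -/
noncomputable def argVec (e : ι → AddChar G Circle) (x : G) : ι →ᵇ ℝ :=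
  ofNormedAddCommGroupDiscrete (fun i => Complex.arg (e i x)) Real.pi
    fun _ => Complex.abs_arg_le_pi _

theorem argVec_apply (e : ι → AddChar G Circle) (x : G) (i : ι) :
    argVec e x i = Complex.arg (e i x) := rfl

theorem mem_bohrSet_iff_norm_argVec_le (e : ι → AddChar G Circle) {r : ℝ} (hr : 0 ≤ r) (x : G) :
    x ∈ bohrSet e r ↔ ‖argVec e x‖ ≤ r := by
  rw [BoundedContinuousFunction.norm_le hr]
  rfl

theorem argVec_mem_argGraph (e : ι → AddChar G Circle) (x : G) : (x, argVec e x) ∈ argGraph e :=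
  fun i => Circle.exp_arg (e i x)

/-- Since 1 < π, a lift of norm at most 1 has not wrapped around the circle. This lets additive
relations among short argument vectors hold exactly, not just modulo 2π. -/
theorem argVec_eq_of_mem_argGraph {e : ι → AddChar G Circle} {x : G} {w : ι →ᵇ ℝ}
    (h : (x, w) ∈ argGraph e) (hw : ‖w‖ ≤ 1) : argVec e x = w := by
  ext i
  have h1 : |w i| ≤ 1 := (w.norm_coe_le_norm i).trans hw
  rw [argVec_apply, ← mem_argGraph.1 h i]
  have := abs_le.1 h1
  exact Circle.arg_exp (by linarith [Real.pi_gt_three]) (by linarith [Real.pi_gt_three])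

/-- A subgroup of a normed space with finitely many elements in the unit ball is discrete. -/
theorem discreteTopology_of_finite_norm_le_one {E : Type*} [NormedAddCommGroup E]
    (L : Submodule ℤ E) (h : {x : L | ‖(x : E)‖ ≤ 1}.Finite) : DiscreteTopology L := by
  refine discreteTopology_of_isOpen_singleton_zero ?_
  have h1 : ({0} : Set L) = Metric.ball 0 1 ∩ ({x : L | ‖(x : E)‖ ≤ 1} \ {0})ᶜ := by
    ext x
    simp only [Set.mem_singleton_iff, Set.mem_inter_iff, mem_ball_zero_iff, Set.mem_compl_iff,
      Set.mem_sdiff, Set.mem_ofPred_eq, not_and, not_not]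
    constructor
    · rintro rfl; simp
    · rintro ⟨h1, h2⟩
      exact h2 (by simpa using h1.le)
  rw [h1]
  exact Metric.isOpen_ball.inter (h.subset Set.sdiff_subset).isClosed.isOpen_compl

/-- A generating set of a free abelian group of rank `k` contains `k` elements which are
linearly independent modulo `2`. -/
theorem exists_linearIndependent_mod_two {L : Type*} [AddCommGroup L] [Module ℤ L] {k : ℕ}
    (b : Basis (Fin k) ℤ L) {S : Set L} (hS : Submodule.span ℤ S = ⊤) :
    ∃ f : Fin k → L, (∀ i, f i ∈ S) ∧ ∀ (I J : Finset (Fin k)) (x y : L),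
      ∑ i ∈ I, f i + 2 • x = ∑ i ∈ J, f i + 2 • y → I = J := by
  classical
  -- Reduction of coordinates mod 2: the image of S spans, so it contains a basis, and distinct
  -- subsets of a basis have distinct sums.
  let p : L →+ (Fin k → ZMod 2) :=
    { toFun := fun l i => (b.repr l i : ZMod 2)
      map_zero' := by ext; simp
      map_add' := fun x y => by ext; simp }
  have hp2 : ∀ x, p (2 • x) = 0 := by
    intro x
    rw [map_nsmul]
    ext i
    simp only [Pi.smul_apply, nsmul_eq_mul, Pi.zero_apply]
    rw [show ((2 : ℕ) : ZMod 2) = 0 from by decide, zero_mul]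
  have hmem : ∀ l, p l ∈ Submodule.span (ZMod 2) (p '' S) := by
    intro l
    have hl : l ∈ Submodule.span ℤ S := hS ▸ Submodule.mem_top
    induction hl using Submodule.span_induction with
    | mem x hx => exact Submodule.subset_span ⟨x, hx, rfl⟩
    | zero => rw [map_zero]; exact zero_mem _
    | add x y _ _ hx hy => rw [map_add]; exact add_mem hx hy
    | smul a x _ hx =>
      have h := map_intCast_smul p ℤ ℤ a x
      rw [Int.cast_id] at h
      rw [h]
      exact zsmul_mem hx a
  have htop : Submodule.span (ZMod 2) (p '' S) = ⊤ := by
    rw [eq_top_iff]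
    rintro y -
    have : p (∑ i, ((y i).val : ℤ) • b i) = y := by
      ext i
      simp [p, Finsupp.single_apply]
    rw [← this]
    exact hmem _
  have hfr : finrank (ZMod 2) (Submodule.span (ZMod 2) (p '' S)) = k := by
    rw [htop, finrank_top]; simp
  obtain ⟨u, hu, -, hli⟩ := Submodule.exists_fun_fin_finrank_span_eq (ZMod 2) (p '' S)
  choose f hfS hf using fun i : Fin k => hu (Fin.cast hfr.symm i)
  have hli' : LinearIndependent (ZMod 2) fun i => p (f i) := by
    simp_rw [hf]
    exact hli.comp _ (Fin.cast_injective _)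
  refine ⟨f, hfS, fun I J x y h => ?_⟩
  have h1 := congrArg p h
  rw [map_add, map_add, hp2, hp2, add_zero, add_zero, map_sum, map_sum] at h1
  have h2 : ∀ I : Finset (Fin k), ∑ i ∈ I, p (f i) =
      Fintype.linearCombination (ZMod 2) (fun i => p (f i)) (fun i => if i ∈ I then 1 else 0) := by
    intro I
    simp [Fintype.linearCombination_apply, Finset.sum_ite_mem]
  rw [h2, h2] at h1
  have h3 := hli'.fintypeLinearCombination_injective h1
  ext i
  have h4 := congrFun h3 i
  by_cases hI : i ∈ I <;> by_cases hJ : i ∈ J <;> simp_all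

/-- A lattice generated by short vectors, given with a parametrization by a group `G`. -/
theorem exists_bohrSet_lattice {E : Type*} [NormedAddCommGroup E] [NormedSpace ℝ E]
    [FiniteDimensional ℝ E] (c : E →ₗᵢ[ℝ] (ι →ᵇ ℝ)) (e : ι → AddChar G Circle) {δ : ℝ}
    (hfin : (bohrSet e 1).Finite) (hc : argVec e '' bohrSet e δ ⊆ Set.range c)
    (hspan : Submodule.span ℝ (c ⁻¹' (argVec e '' bohrSet e δ)) = ⊤) :
    ∃ (k : ℕ) (L : Submodule ℤ E) (b : Basis (Fin k) ℤ L)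
      (B : Basis (Fin k) ℝ E), (∀ i, B i = (b i : E)) ∧
      (∀ l : L, ∃ x, (x, c l) ∈ argGraph e) ∧
      (∀ x ∈ bohrSet e δ, ∃ l : L, c l = argVec e x) ∧
      Submodule.span ℤ {l : L | ∃ x ∈ bohrSet e δ, c l = argVec e x} = ⊤ := by
  let S' : Set E := c ⁻¹' (argVec e '' bohrSet e δ)
  let L : Submodule ℤ E := Submodule.span ℤ S'
  have hL : ∀ l ∈ L, ∃ x, (x, c l) ∈ argGraph e := by
    intro l hl
    induction hl using Submodule.span_induction with
    | mem l hl =>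
      obtain ⟨x, _, hx⟩ := hl
      exact ⟨x, hx ▸ argVec_mem_argGraph e x⟩
    | zero => exact ⟨0, by rw [map_zero]; exact (argGraph e).zero_mem⟩
    | add l l' _ _ hl hl' =>
      obtain ⟨x, hx⟩ := hl
      obtain ⟨y, hy⟩ := hl'
      exact ⟨x + y, by rw [map_add]; exact (argGraph e).add_mem hx hy⟩
    | smul a l _ hl =>
      obtain ⟨x, hx⟩ := hl
      exact ⟨a • x, by rw [map_zsmul]; exact (argGraph e).zsmul_mem hx a⟩
  -- An element of L of norm at most 1 is the argument vector of an element of the width-1 Bohr set,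
  -- so there are finitely many.
  have hdisc : DiscreteTopology L := by
    refine discreteTopology_of_finite_norm_le_one L ?_
    refine Set.Finite.of_finite_image (f := fun l : L => c l)
      ((hfin.image (argVec e)).subset ?_)
      (fun a _ b _ h => Subtype.ext (c.injective h))
    rintro _ ⟨l, hl, rfl⟩
    obtain ⟨x, hx⟩ := hL l l.2
    have hl' : ‖c l‖ ≤ 1 := by rw [c.norm_map]; exact hl
    have h1 := argVec_eq_of_mem_argGraph hx hl'
    exact ⟨x, (mem_bohrSet_iff_norm_argVec_le e zero_le_one x).2 (h1 ▸ hl'), h1⟩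
  have hlat : IsZLattice ℝ L :=
    ⟨eq_top_iff.mpr (hspan.symm.le.trans (Submodule.span_mono Submodule.subset_span))⟩
  have := ZLattice.module_free ℝ L
  have := ZLattice.module_finite ℝ L
  let b : Basis (Fin (finrank ℤ L)) ℤ L := finBasis ℤ L
  refine ⟨_, L, b, b.ofZLatticeBasis ℝ L, by simp, fun l => hL l l.2, ?_, ?_⟩
  · intro x hx
    obtain ⟨v, hv⟩ := hc ⟨x, hx, rfl⟩
    exact ⟨⟨v, Submodule.subset_span ⟨x, hx, hv.symm⟩⟩, hv⟩
  · rw [← Submodule.span_span_coe_preimage (R := ℤ) (s := S')]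
    congr 1
    ext l
    simp only [Set.mem_ofPred_eq, S', Set.mem_preimage, Set.mem_image]
    exact ⟨fun ⟨x, hx, h⟩ => ⟨x, hx, h.symm⟩, fun ⟨x, hx, h⟩ => ⟨x, hx, h.symm⟩⟩

/-- The family of characters may be infinite, so the lattice is placed in a finite-dimensional space
E embedded isometrically in ι →ᵇ ℝ. The convex body is then the δ-ball of E in lattice coordinates.
-/
theorem exists_isCentredConvexCosetProgression_bohrSet_of_span {E : Type*} [NormedAddCommGroup E]
    [NormedSpace ℝ E] [FiniteDimensional ℝ E] (c : E →ₗᵢ[ℝ] (ι →ᵇ ℝ))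
    (e : ι → AddChar G Circle) {δ : ℝ} (hδ0 : 0 < δ) (hδ : δ ≤ 1) (hfin : (bohrSet e 1).Finite)
    (hc : argVec e '' bohrSet e δ ⊆ Set.range c)
    (hspan : Submodule.span ℝ (c ⁻¹' (argVec e '' bohrSet e δ)) = ⊤) :
    ∃ k, IsCentredConvexCosetProgression k (bohrSet e δ) ∧
      ∀ j ≤ k, (j + 2) * δ ≤ 1 → 2 ^ j * (bohrSet e δ).ncard ≤ (bohrSet e 1).ncard := by
  classical
  obtain ⟨k, L, b, B, hBb, hLG, hSL, hspan'⟩ := exists_bohrSet_lattice c e hfin hc hspan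
  refine ⟨k, ?_, ?_⟩
  · choose g hg using fun i => hLG (b i)
    let φ : (Fin k → ℤ) →+ G := (Fintype.linearCombination ℤ g).toAddMonoidHom
    have hφ : ∀ z : Fin k → ℤ,
        (φ z, c (∑ i, z i • b i : L)) ∈ argGraph e := by
      intro z
      have := sum_mem fun i (_ : i ∈ Finset.univ) => (argGraph e).zsmul_mem (hg i) (z i)
      convert! this using 1
      ext1
      · simp [φ, Fintype.linearCombination_apply, Prod.fst_sum]
      · simp [Prod.snd_sum]
    have hB : ∀ z : Fin k → ℤ,
        B.equivFun.symm (fun i => (z i : ℝ)) = ((∑ i, z i • b i : L) : E) := by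
      intro z
      simp only [Basis.equivFun_symm_apply, hBb, Submodule.coe_sum]
      exact Finset.sum_congr rfl fun i _ => Int.cast_smul_eq_zsmul ℝ (z i) _
    let T : (Fin k → ℝ) ≃L[ℝ] E := B.equivFun.symm.toContinuousLinearEquiv
    let Q : Set (Fin k → ℝ) := T ⁻¹' Metric.closedBall 0 δ
    have hQ : ∀ z : Fin k → ℤ, (fun i => (z i : ℝ)) ∈ Q ↔
        ‖c (∑ i, z i • b i : L)‖ ≤ δ := by
      intro z
      rw [← hB, c.norm_map]
      simp [Q, T]
    let H : AddSubgroup G :=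
      { carrier := {x | ∀ i, e i x = 1}
        zero_mem' := by simp
        add_mem' := fun ha hb i => by
          rw [AddChar.map_add_eq_mul, ha i, hb i, one_mul]
        neg_mem' := fun ha i => by rw [AddChar.map_neg_eq_inv, ha i, inv_one] }
    refine ⟨H, φ '' {z | (fun i => (z i : ℝ)) ∈ Q}, ⟨Q, φ, ⟨?_, ?_, ?_, ?_⟩, rfl⟩, ?_⟩
    · exact (convex_closedBall 0 δ).linear_preimage T.toLinearMap
    · have : ProperSpace E := FiniteDimensional.proper ℝ E
      exact T.toHomeomorph.isCompact_preimage.2 (isCompact_closedBall 0 δ)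
    · refine ⟨0, mem_interior_iff_mem_nhds.2 (T.continuous.continuousAt.preimage_mem_nhds ?_)⟩
      rw [map_zero]
      exact Metric.closedBall_mem_nhds 0 hδ0
    · intro x hx
      simpa [Q] using hx
    · ext x
      rw [Set.mem_add]
      constructor
      · intro hx
        obtain ⟨l, hl⟩ := hSL x hx
        have hz : ∑ i, b.equivFun l i • b i = l := b.sum_equivFun l
        refine ⟨x - φ (b.equivFun l), fun i => ?_, φ (b.equivFun l),
          ⟨_, (hQ _).2 ?_, rfl⟩, sub_add_cancel _ _⟩
        · have h1 := hφ (b.equivFun l)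
          rw [hz, hl] at h1
          have h2 := argVec_mem_argGraph e x i
          have h3 := h1 i
          rw [sub_eq_add_neg, AddChar.map_add_eq_mul, AddChar.map_neg_eq_inv]
          rw [← h3, ← h2, mul_inv_cancel]
        · rw [hz, hl]
          exact (mem_bohrSet_iff_norm_argVec_le e hδ0.le x).1 hx
      · rintro ⟨h, hh, _, ⟨z, hz, rfl⟩, rfl⟩ i
        have h1 := argVec_eq_of_mem_argGraph (hφ z) (((hQ z).1 hz).trans hδ)
        have h2 : φ z ∈ bohrSet e δ := by
          rw [mem_bohrSet_iff_norm_argVec_le e hδ0.le, h1]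
          exact (hQ z).1 hz
        have h3 : e i h = 1 := hh i
        rw [AddChar.map_add_eq_mul, h3, one_mul]
        exact h2 i
  · intro j hj hjδ
    obtain ⟨f, hfS, hf⟩ := exists_linearIndependent_mod_two b hspan'
    choose x hx hfx using hfS
    obtain ⟨J, -, hJ⟩ := Finset.exists_subset_card_eq
      (show j ≤ (Finset.univ : Finset (Fin k)).card by simpa using hj)
    have hfinδ := hfin.subset (bohrSet_mono e hδ)
    let rep : (ι →ᵇ ℝ) → G := Function.invFunOn (argVec e) (bohrSet e δ)
    have hrep : ∀ y ∈ bohrSet e δ, argVec e (rep (argVec e y)) = argVec e y := fun y hy =>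
      Function.invFunOn_eq ⟨y, hy, rfl⟩
    -- The argument vector of F(I, y) is ∑_{i ∈ I} f i plus twice that of y, so it determines I (mod
    -- 2) and then `argVec e y`. Using y + rep rather than 2y keeps y recoverable when G has
    -- 2-torsion: rep depends only on the argument vector and cancels.
    let F : Finset (Fin k) × G → G := fun p => ∑ i ∈ p.1, x i + p.2 + rep (argVec e p.2)
    have hF : ∀ p : Finset (Fin k) × G, p.1 ⊆ J → p.2 ∈ bohrSet e δ →
        ‖∑ i ∈ p.1, argVec e (x i) + 2 • argVec e p.2‖ ≤ 1 ∧
        argVec e (F p) = ∑ i ∈ p.1, argVec e (x i) + 2 • argVec e p.2 := by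
      rintro ⟨I, y⟩ hI hy
      have hnorm : ‖∑ i ∈ I, argVec e (x i) + 2 • argVec e y‖ ≤ 1 := by
        have h1 : ‖∑ i ∈ I, argVec e (x i)‖ ≤ j * δ := by
          refine (norm_sum_le_of_le I fun i _ =>
            (mem_bohrSet_iff_norm_argVec_le e hδ0.le _).1 (hx i)).trans ?_
          rw [Finset.sum_const, nsmul_eq_mul, ← hJ]
          exact mul_le_mul_of_nonneg_right (by exact_mod_cast Finset.card_le_card hI) hδ0.le
        have h2 : ‖2 • argVec e y‖ ≤ 2 * δ := by
          rw [two_nsmul, two_mul]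
          have := (mem_bohrSet_iff_norm_argVec_le e hδ0.le y).1 hy
          exact (norm_add_le _ _).trans (add_le_add this this)
        refine (norm_add_le _ _).trans ?_
        linarith
      refine ⟨hnorm, argVec_eq_of_mem_argGraph ?_ hnorm⟩
      have h1 := sum_mem fun i (_ : i ∈ I) => argVec_mem_argGraph e (x i)
      have h2 := argVec_mem_argGraph e (rep (argVec e y))
      rw [hrep y hy] at h2
      have h3 := add_mem (add_mem h1 (argVec_mem_argGraph e y)) h2
      convert! h3 using 1
      ext1
      · simp [F, Prod.fst_sum]
      · simp [Prod.snd_sum, two_mul, add_assoc]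
    rw [Set.ncard_eq_toFinset_card _ hfin, Set.ncard_eq_toFinset_card _ hfinδ, ← hJ,
      ← Finset.card_powerset, ← Finset.card_product]
    refine Finset.card_le_card_of_injOn F ?_ ?_
    · rintro ⟨I, y⟩ hp
      simp only [Finset.coe_product, Set.mem_prod, Finset.mem_coe, Finset.mem_powerset,
        Set.Finite.mem_toFinset] at hp
      obtain ⟨h1, h2⟩ := hF (I, y) hp.1 hp.2
      simp only [Finset.mem_coe, Set.Finite.mem_toFinset]
      rw [mem_bohrSet_iff_norm_argVec_le e zero_le_one, h2]
      exact h1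
    · rintro ⟨I, y⟩ hp ⟨I', y'⟩ hp' hFF
      simp only [Finset.coe_product, Set.mem_prod, Finset.mem_coe, Finset.mem_powerset,
        Set.Finite.mem_toFinset] at hp hp'
      have h1 := (hF (I, y) hp.1 hp.2).2
      have h2 := (hF (I', y') hp'.1 hp'.2).2
      rw [hFF, h2] at h1
      obtain ⟨l, hl⟩ := hSL y hp.2
      obtain ⟨l', hl'⟩ := hSL y' hp'.2
      have h3 : ∑ i ∈ I, f i + 2 • l = ∑ i ∈ I', f i + 2 • l' := by
        apply Subtype.ext
        apply c.injective
        push_cast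
        rw [map_add, map_add, map_nsmul, map_nsmul, map_sum, map_sum]
        simp only [hfx, hl, hl']
        exact h1.symm
      have hII := hf _ _ _ _ h3
      subst hII
      simp only at h1
      have h4 : argVec e y = argVec e y' := by
        have h5 := add_left_cancel h1
        ext i
        have h6 := DFunLike.congr_fun h5 i
        simpa using h6.symm
      simp only [F, h4] at hFF
      rw [add_left_inj, add_right_inj] at hFF
      rw [hFF]

/-- If the Bohr set of width `1` is finite, then the Bohr set of width `δ ≤ 1` is a convex coset
progression, whose dimension is controlled by the growth of Bohr sets. -/
theorem exists_isCentredConvexCosetProgression_bohrSet (e : ι → AddChar G Circle) {δ : ℝ}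
    (hδ0 : 0 < δ) (hδ : δ ≤ 1) (hfin : (bohrSet e 1).Finite) :
    ∃ k, IsCentredConvexCosetProgression k (bohrSet e δ) ∧
      ∀ j ≤ k, (j + 2) * δ ≤ 1 → 2 ^ j * (bohrSet e δ).ncard ≤ (bohrSet e 1).ncard := by
  have hS : (argVec e '' bohrSet e δ).Finite := (hfin.subset (bohrSet_mono e hδ)).image _
  have := FiniteDimensional.span_of_finite ℝ hS
  let E := Submodule.span ℝ (argVec e '' bohrSet e δ)
  let c : E →ₗᵢ[ℝ] (ι →ᵇ ℝ) := { toLinearMap := E.subtype, norm_map' := fun _ => rfl }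
  refine exists_isCentredConvexCosetProgression_bohrSet_of_span (E := E) c e hδ0 hδ hfin ?_ ?_
  · intro v hv
    exact ⟨⟨v, Submodule.subset_span hv⟩, rfl⟩
  · exact Submodule.span_span_coe_preimage

end BohrSet

/-! ### Sets of polynomial growth -/

section Growth

variable {G : Type*} [AddCommGroup G] [DecidableEq G]

theorem iteratedSumset_coe (n : ℕ) (X : Finset G) :
    iteratedSumset n (X : Set G) = ((n • X : Finset G) : Set G) := by
  ext g
  rw [Finset.coe_nsmul, Set.mem_nsmul]
  constructor
  · rintro ⟨x, hx, rfl⟩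
    exact ⟨fun i => ⟨x i, hx i⟩, by simp [List.sum_ofFn]⟩
  · rintro ⟨f, rfl⟩
    exact ⟨fun i => f i, fun i => (f i).2, by simp [List.sum_ofFn]⟩

theorem card_le_card_nsmul {X : Finset G} (hX : X.Nonempty) {n : ℕ} (hn : 1 ≤ n) :
    X.card ≤ (n • X).card := by
  obtain ⟨n, rfl⟩ := Nat.exists_eq_add_of_le' hn
  rw [succ_nsmul]
  exact Finset.card_le_card_add_left hX.nsmul

variable {X : Finset G} {q : ℕ}

/-- A set of polynomial growth has an iterated sumset which is almost invariant. -/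
theorem exists_card_nsmul_add_le (hX : X.Nonempty) (hq : 2 ≤ q)
    (h : ∀ n, 1 ≤ n → (n • X).card ≤ n ^ q * X.card) :
    ∃ n, 1 ≤ n ∧ n ≤ q ^ 28 ∧
      ((n • X + X).card : ℝ) ≤ (1 + 1 / (q : ℝ) ^ 20) * ((n • X).card : ℝ) := by
  by_contra! hcon
  have hq0 : (0 : ℝ) < (q : ℝ) ^ 20 := by positivity
  have hXc : (0 : ℝ) < X.card := by simpa using hX
  -- If every step up to q²⁸ expands by 1 + q⁻²⁰, the total expansion is at least 2^(q⁸), exceeding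
  -- the polynomial bound 2^(29q²).
  have key : ∀ n ≤ q ^ 28,
      (1 + 1 / (q : ℝ) ^ 20) ^ n * X.card ≤ (((n + 1) • X).card : ℝ) := by
    intro n
    induction n with
    | zero => intro _; simp
    | succ n ih =>
      intro hn
      have h1 := ih (by omega)
      have h2 := hcon (n + 1) (by omega) hn
      rw [← succ_nsmul] at h2
      calc _ = (1 + 1 / (q : ℝ) ^ 20) * ((1 + 1 / (q : ℝ) ^ 20) ^ n * X.card) := by ring
        _ ≤ (1 + 1 / (q : ℝ) ^ 20) * (((n + 1) • X).card : ℝ) := by gcongr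
        _ ≤ _ := h2.le
  have h1 := key _ le_rfl
  have h2 : (((q ^ 28 + 1) • X).card : ℝ) ≤ ((q ^ 28 + 1 : ℕ) : ℝ) ^ q * X.card := by
    exact_mod_cast h (q ^ 28 + 1) (by omega)
  have h3 := le_of_mul_le_mul_right (h1.trans h2) hXc
  have h4 : (2 : ℝ) ^ (q ^ 8) ≤ (1 + 1 / (q : ℝ) ^ 20) ^ (q ^ 28) := by
    rw [show 28 = 20 + 8 from rfl, pow_add, pow_mul]
    refine pow_le_pow_left₀ (by norm_num) ?_ _
    have := one_add_mul_le_pow (a := 1 / (q : ℝ) ^ 20)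
      ((by norm_num : (-2 : ℝ) ≤ 0).trans (by positivity)) (q ^ 20)
    refine le_trans (le_of_eq ?_) this
    push_cast
    field_simp
    norm_num
  have h5 : 2 ^ (q ^ 8) ≤ (q ^ 28 + 1) ^ q := by exact_mod_cast h4.trans h3
  have h6 : q ^ 28 + 1 ≤ q ^ 29 := by
    rw [pow_succ q 28]
    nlinarith [Nat.one_le_pow 28 q (by omega)]
  have h7 : (q ^ 28 + 1) ^ q ≤ 2 ^ (29 * q ^ 2) := by
    calc (q ^ 28 + 1) ^ q ≤ (q ^ 29) ^ q := Nat.pow_le_pow_left h6 q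
      _ = q ^ (29 * q) := by rw [← pow_mul]
      _ ≤ (2 ^ q) ^ (29 * q) := Nat.pow_le_pow_left Nat.lt_two_pow_self.le _
      _ = 2 ^ (29 * q ^ 2) := by rw [← pow_mul]; congr 1; ring
  have h8 := (Nat.pow_le_pow_iff_right (by norm_num)).1 (h5.trans h7)
  have h9 : 2 ^ 6 ≤ q ^ 6 := Nat.pow_le_pow_left hq 6
  have h10 : 0 < q ^ 2 := by positivity
  rw [show 8 = 6 + 2 from rfl, pow_add] at h8
  have := Nat.le_of_mul_le_mul_right h8 h10
  omega

theorem mul_le_pow_thirtySeven (hq : 2 ≤ q) {n : ℕ} (hn : n ≤ q ^ 28) :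
    (q ^ 8 + 1) * n ≤ q ^ 37 := by
  have h1 : q ^ 8 + 1 ≤ q ^ 9 := by
    rw [pow_succ q 8]
    nlinarith [Nat.one_le_pow 8 q (by omega)]
  calc (q ^ 8 + 1) * n ≤ q ^ 9 * q ^ 28 := Nat.mul_le_mul h1 hn
    _ = q ^ 37 := by ring

/-- The hypothesis of Bogolyubov's argument with m = q⁸: growth costs at most q^(37q), which 4^(q⁸)
beats. -/
theorem three_mul_card_nsmul_lt (hX : X.Nonempty) (hq : 2 ≤ q)
    (h : ∀ n, 1 ≤ n → (n • X).card ≤ n ^ q * X.card) {n : ℕ} (hn1 : 1 ≤ n) (hn : n ≤ q ^ 28) :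
    3 * ((q ^ 8 + 1) • n • X).card < 4 ^ (q ^ 8) * (n • X).card := by
  have hXc : 0 < X.card := hX.card_pos
  have h1 : ((q ^ 8 + 1) • n • X).card ≤ ((q ^ 8 + 1) * n) ^ q * X.card := by
    rw [← mul_nsmul', mul_comm]
    exact mul_comm n (q ^ 8 + 1) ▸ h _ (Nat.mul_pos (by omega) hn1)
  have h2 : 3 * ((q ^ 8 + 1) * n) ^ q < 4 ^ (q ^ 8) := by
    have h9 : 2 ^ 6 ≤ q ^ 6 := Nat.pow_le_pow_left hq 6
    have h10 : 0 < q ^ 2 := by positivity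
    calc 3 * ((q ^ 8 + 1) * n) ^ q ≤ q ^ q * (q ^ 37) ^ q := by
          have : 3 ≤ q ^ q := by
            calc 3 ≤ 2 ^ 2 := by norm_num
              _ ≤ q ^ 2 := Nat.pow_le_pow_left hq 2
              _ ≤ q ^ q := Nat.pow_le_pow_right (by omega) hq
          exact Nat.mul_le_mul this (Nat.pow_le_pow_left (mul_le_pow_thirtySeven hq hn) q)
      _ = q ^ (38 * q) := by rw [← pow_mul, ← pow_add]; congr 1; ring
      _ ≤ (2 ^ q) ^ (38 * q) := Nat.pow_le_pow_left Nat.lt_two_pow_self.le _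
      _ = 2 ^ (38 * q ^ 2) := by rw [← pow_mul]; congr 1; ring
      _ < 2 ^ (2 * q ^ 8) := by
          refine Nat.pow_lt_pow_right (by norm_num) ?_
          rw [show 8 = 6 + 2 from rfl, pow_add]
          nlinarith
      _ = 4 ^ (q ^ 8) := by rw [pow_mul, show 2 ^ 2 = 4 from rfl]
  calc 3 * ((q ^ 8 + 1) • n • X).card ≤ 3 * (((q ^ 8 + 1) * n) ^ q * X.card) := by omega
    _ = 3 * ((q ^ 8 + 1) * n) ^ q * X.card := by ring
    _ < 4 ^ (q ^ 8) * X.card := Nat.mul_lt_mul_of_pos_right h2 hXc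
    _ ≤ _ := Nat.mul_le_mul_left _ (card_le_card_nsmul hX hn1)

theorem card_nsmul_sub_nsmul_le (hX : X.Nonempty) (hq : 2 ≤ q)
    (h : ∀ n, 1 ≤ n → (n • X).card ≤ n ^ q * X.card) {n : ℕ} (hn1 : 1 ≤ n) (hn : n ≤ q ^ 28) :
    ((q ^ 8 + 1) • n • X - (q ^ 8 + 1) • n • X).card ≤ q ^ (76 * q) * X.card := by
  have hXc : 0 < X.card := hX.card_pos
  set Y := (q ^ 8 + 1) • n • X with hY
  have hYX : Y = ((q ^ 8 + 1) * n) • X := by rw [hY, ← mul_nsmul', mul_comm]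
  have hpos : 0 < (q ^ 8 + 1) * n := Nat.mul_pos (by omega) hn1
  have h1 : (Y + Y).card ≤ q ^ (38 * q) * X.card := by
    rw [hYX, ← add_nsmul]
    refine (h _ (by omega)).trans (Nat.mul_le_mul_right _ ?_)
    rw [pow_mul]
    refine Nat.pow_le_pow_left ?_ q
    have := mul_le_pow_thirtySeven hq hn
    rw [pow_succ q 37]
    nlinarith
  have h2 : X.card ≤ Y.card := hYX ▸ card_le_card_nsmul hX hpos
  -- Ruzsa's triangle inequality passes from sums to differences, as growth is only assumed for
  -- sumsets.
  have h3 := Finset.ruzsa_triangle_inequality_sub_add_add Y Y Y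
  have h4 : (Y - Y).card * X.card ≤ q ^ (76 * q) * X.card * X.card := by
    calc (Y - Y).card * X.card ≤ (Y - Y).card * Y.card := Nat.mul_le_mul_left _ h2
      _ ≤ (Y + Y).card * (Y + Y).card := h3
      _ ≤ (q ^ (38 * q) * X.card) * (q ^ (38 * q) * X.card) := Nat.mul_le_mul h1 h1
      _ = q ^ (76 * q) * X.card * X.card := by
          rw [show 76 * q = 38 * q + 38 * q by ring, pow_add]; ring
  exact Nat.le_of_mul_le_mul_right h4 hXc

/-- A finite set of polynomial growth is efficiently contained in a convex coset progression. -/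
theorem exists_isCentredConvexCosetProgression_of_card_nsmul_le (hX : X.Nonempty) (hq : 2 ≤ q)
    (h : ∀ n, 1 ≤ n → (n • X).card ≤ n ^ q * X.card) :
    ∃ (k : ℕ) (M : Set G), IsCentredConvexCosetProgression k M ∧ (X : Set G) - X ⊆ M ∧ M.Finite ∧
      M.ncard ≤ q ^ (76 * q) * X.card ∧ 2 ^ k ≤ q ^ (76 * q) := by
  obtain ⟨n, hn1, hn, hinv⟩ := exists_card_nsmul_add_le hX hq h
  obtain ⟨Ω, _, μ, e, _, hm, h0⟩ := exists_dual_probability G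
  set A := n • X with hAdef
  have hA : A.Nonempty := hX.nsmul
  let Λ : Type _ := {ω : Ω // (A.card : ℝ) / 2 ≤ ‖∑ a ∈ A, (e ω a : ℂ)‖}
  let _ : TopologicalSpace Λ := ⊥
  have : DiscreteTopology Λ := ⟨rfl⟩
  let f : Λ → AddChar G Circle := fun ω => e ω.1
  have hsub1 : bohrSet f 1 ⊆ (((q ^ 8 + 1) • A - (q ^ 8 + 1) • A : Finset G) : Set G) :=
    fun x hx => mem_nsmul_sub_nsmul_of_abs_arg_le μ e hm h0 hA
      (by exact_mod_cast three_mul_card_nsmul_lt hX hq h hn1 hn) fun ω hω => hx ⟨ω, hω⟩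
  have hfin : (bohrSet f 1).Finite := (Finset.finite_toSet _).subset hsub1
  have hcard1 : (bohrSet f 1).ncard ≤ q ^ (76 * q) * X.card := by
    refine (Set.ncard_le_ncard hsub1 (Finset.finite_toSet _)).trans ?_
    rw [Set.ncard_coe_finset]
    exact card_nsmul_sub_nsmul_le hX hq h hn1 hn
  set δ : ℝ := 7 * (1 / (q : ℝ) ^ 20) with hδ
  have hq2 : (2 : ℝ) ≤ q := by exact_mod_cast hq
  have hδ0 : 0 < δ := by positivity
  have hδj : ((76 * q ^ 2 + 1 : ℕ) + 2) * δ ≤ 1 := by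
    have h1 : (2 : ℝ) ^ 18 ≤ (q : ℝ) ^ 18 := pow_le_pow_left₀ (by norm_num) hq2 18
    have h2 : (2 : ℝ) ^ 2 ≤ (q : ℝ) ^ 2 := pow_le_pow_left₀ (by norm_num) hq2 2
    have h3 : (q : ℝ) ^ 20 = (q : ℝ) ^ 18 * (q : ℝ) ^ 2 := by ring
    have h4 : (0 : ℝ) < (q : ℝ) ^ 20 := by positivity
    rw [hδ, mul_one_div, ← mul_div_assoc, div_le_one h4]
    push_cast
    nlinarith
  have hδ1 : δ ≤ 1 := by
    push_cast at hδj
    nlinarith [mul_nonneg (sq_nonneg (q : ℝ)) hδ0.le]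
  have hXM : (X : Set G) - X ⊆ bohrSet f δ := by
    rintro _ ⟨x, hx, y, hy, rfl⟩ ω
    exact abs_arg_sub_le hA hinv _ ω.2 hx hy
  have hfinδ : (bohrSet f δ).Finite := hfin.subset (bohrSet_mono f hδ1)
  have hXδ : X.card ≤ (bohrSet f δ).ncard := by
    rw [← Finset.coe_sub] at hXM
    have := Set.ncard_le_ncard hXM hfinδ
    rw [Set.ncard_coe_finset] at this
    exact (Finset.card_le_card_sub_right hX).trans this
  obtain ⟨k, hk, hgrow⟩ := exists_isCentredConvexCosetProgression_bohrSet f hδ0 hδ1 hfin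
  have hpow : ∀ j ≤ k, ((j : ℝ) + 2) * δ ≤ 1 → 2 ^ j ≤ q ^ (76 * q) := by
    intro j hj hjδ
    refine Nat.le_of_mul_le_mul_right ?_ hX.card_pos
    exact ((Nat.mul_le_mul_left _ hXδ).trans (hgrow j hj hjδ)).trans hcard1
  have hlog : q ^ (76 * q) ≤ 2 ^ (76 * q ^ 2) := by
    calc q ^ (76 * q) ≤ (2 ^ q) ^ (76 * q) := Nat.pow_le_pow_left Nat.lt_two_pow_self.le _
      _ = 2 ^ (76 * q ^ 2) := by rw [← pow_mul]; congr 1; ring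
  -- The packing bound applies only while (j + 2)δ ≤ 1. Testing j = 76q² + 1 first gives this crude
  -- bound on k, after which j = k is admissible and yields the sharp one.
  have hk76 : k ≤ 76 * q ^ 2 := by
    by_contra! hlt
    have := (Nat.pow_le_pow_iff_right (by norm_num)).1 ((hpow _ hlt hδj).trans hlog)
    omega
  refine ⟨k, _, hk, hXM, hfinδ,
    (Set.ncard_le_ncard (bohrSet_mono f hδ1) hfin).trans hcard1, hpow k le_rfl ?_⟩
  refine le_trans (mul_le_mul_of_nonneg_right ?_ hδ0.le) hδj
  have : (k : ℝ) ≤ (76 * q ^ 2 + 1 : ℕ) := by exact_mod_cast hk76.trans (Nat.le_succ _)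
  linarith

end Growth

/-! ### Passing from the integer exponent back to the real exponent -/

theorem ceil_mul_log_ceil_le {D : ℝ} (hD : 2 ≤ D) :
    (⌈D⌉₊ : ℝ) * Real.log ⌈D⌉₊ ≤ 3 * (D * Real.log D) := by
  have h1 : (⌈D⌉₊ : ℝ) ≤ 3 / 2 * D := by linarith [Nat.ceil_lt_add_one (show 0 ≤ D by linarith)]
  have h2 : (0 : ℝ) < ⌈D⌉₊ := by
    have := Nat.le_ceil D
    linarith
  have h3 : Real.log ⌈D⌉₊ ≤ 2 * Real.log D := by
    have : 2 * Real.log D = Real.log (D ^ 2) := by simp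
    rw [this]
    exact Real.log_le_log h2 (by nlinarith)
  have h4 : 0 ≤ Real.log D := Real.log_nonneg (by linarith)
  calc _ ≤ (⌈D⌉₊ : ℝ) * (2 * Real.log D) := by gcongr
    _ ≤ 3 / 2 * D * (2 * Real.log D) := by gcongr
    _ = _ := by ring

theorem mainTheorem4 :
    ∃ C : ℝ, 0 < C ∧
      ∀ (G : Type*) [AddCommGroup G] (X : Set G) (d : ℝ),
        X.Finite → X.Nonempty → HasRelativePolynomialGrowth d X →
        ∃ (k : ℕ) (M : Set G),
          IsCentredConvexCosetProgression k M ∧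
          X - X ⊆ M ∧
          M.Finite ∧
          (M.ncard : ℝ) ≤ Real.exp (C * (max d 2 * Real.log (max d 2))) * (X.ncard : ℝ) ∧
          (k : ℝ) ≤ C * (max d 2 * Real.log (max d 2)) := by
  classical
  -- 456 = 76 · 3 · 2: the exponent 76q, the rounding loss in `ceil_mul_log_ceil_le`, and log 2 ≥
  -- 1/2 when bounding k.
  refine ⟨456, by norm_num, fun G _ X d hfin hne hgrow => ?_⟩
  lift X to Finset G using hfin
  set D := max d 2
  have hD : 2 ≤ D := le_max_right _ _
  have hq : 2 ≤ ⌈D⌉₊ := by exact_mod_cast hD.trans (Nat.le_ceil D)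
  have hq0 : (0 : ℝ) < ⌈D⌉₊ := by exact_mod_cast (by omega : 0 < ⌈D⌉₊)
  have hlogD : 0 ≤ D * Real.log D := mul_nonneg (by linarith) (Real.log_nonneg (by linarith))
  have h : ∀ n, 1 ≤ n → (n • X).card ≤ n ^ ⌈D⌉₊ * X.card := by
    intro n hn
    have h1 := hgrow n hn
    rw [iteratedSumset_coe, Set.ncard_coe_finset, Set.ncard_coe_finset] at h1
    have h2 : (n : ℝ) ^ d ≤ (n : ℝ) ^ ⌈D⌉₊ := by
      rw [← Real.rpow_natCast]
      exact Real.rpow_le_rpow_of_exponent_le (by exact_mod_cast hn)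
        ((le_max_left _ _).trans (Nat.le_ceil D))
    exact_mod_cast h1.trans (mul_le_mul_of_nonneg_right h2 (Nat.cast_nonneg _))
  obtain ⟨k, M, hM, hXM, hMfin, hcard, hk⟩ :=
    exists_isCentredConvexCosetProgression_of_card_nsmul_le (by exact_mod_cast hne) hq h
  have hexp : ((⌈D⌉₊ ^ (76 * ⌈D⌉₊) : ℕ) : ℝ) = Real.exp (76 * (⌈D⌉₊ * Real.log ⌈D⌉₊)) := by
    rw [← mul_assoc, mul_comm _ (Real.log _), Real.exp_mul, Real.exp_log hq0, Nat.cast_pow, ← Real.rpow_natCast]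
    push_cast
    rfl
  have hle := ceil_mul_log_ceil_le hD
  refine ⟨k, M, hM, hXM, hMfin, ?_, ?_⟩
  · rw [Set.ncard_coe_finset]
    have h1 : (M.ncard : ℝ) ≤ ((⌈D⌉₊ ^ (76 * ⌈D⌉₊) : ℕ) : ℝ) * X.card := by exact_mod_cast hcard
    refine h1.trans (mul_le_mul_of_nonneg_right ?_ (Nat.cast_nonneg _))
    rw [hexp, Real.exp_le_exp]
    linarith
  · have h1 : (2 : ℝ) ^ k ≤ ((⌈D⌉₊ ^ (76 * ⌈D⌉₊) : ℕ) : ℝ) := by exact_mod_cast hk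
    have h2 := Real.log_le_log (by positivity) h1
    rw [hexp, Real.log_exp, Real.log_pow] at h2
    have h3 : (k : ℝ) * (1 / 2) ≤ k * Real.log 2 := by
      gcongr
      linarith [Real.log_two_gt_d9]
    linarith
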